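/- Let $X$ be a complex Banach space with closed unit ball $B_X$ and unit sphere $S_X$. Let $\mathcal{A}_u(B_X)$ be the algebra of all bounded, uniformly continuous functions $f : B_X \to \mathbb{C}$ that are holomorphic on the interior of $B_X$. A point $p \in B_X$ is a *strong peak point* for $\mathcal{A}_u(B_X)$ if there is $f \in \mathcal{A}_u(B_X)$ with $f(p) = 1$ such that for every $\epsilon > 0$ there is $\delta > 0$ with $|f(x)| < 1 - \delta$ whenever $x \in B_X$ and $\|x - p\| > \epsilon$. For $x \in B_X$ put $\mathcal{F}(x) = \{x + y : y \in X,\ \sup_{|\zeta| \le 1} \|x + \zeta y\| \le 1\}$ (with $\zeta \in \mathbb{C}$). The space $X$ is *locally c-convex* if 1. every $x \in S_X$ is a complex extreme point of $B_X$, that is, for every nonzero $y \in X$ there is $\zeta \in \mathbb{C}$ with $|\zeta| \le 1$ and $\|x + \zeta y\| > 1$; and 2. for every $x \in S_X$ and every $\epsilon > 0$ there is $\delta > 0$ such that $\sup_{0 \le \theta \le 2\pi} \|x + e^{i\theta}(x - y)\| \ge 1 + \delta$ for all $y \in X$ with $\mathrm{dist}(y, \mathcal{F}(x)) \ge \epsilon$.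 A *Banach sequence space* is a complex Banach space $X$ consisting of complex sequences $x = (x(k))_{k \in \mathbb{N}}$, with coordinatewise operations, such that if $y \in X$ and $u$ is a complex sequence with $|u(k)| \le |y(k)|$ for all $k$, then $u \in X$ and $\|u\| \le \|y\|$. For complex sequences write $x \le y$ if $y(k) - x(k)$ is a nonnegative real number for all $k$. The space $X$ is *order continuous* if every sequence $(x_n)$ in $X$ with $0 \le x_1 \le x_2 \le \cdots \le y$ for some $y \in X$, $y \ge 0$, converges in norm. **Corollary.** Let $X$ be a locally c-convex Banach sequence space. Then every $x_0 \in S_X$ with finite support $\{k : x_0(k) \ne 0\}$ is a strong peak point for $\mathcal{A}_u(B_X)$. If, in addition, $X$ is order continuous, then the set of strong peak points for $\mathcal{A}_u(B_X)$ lying in $S_X$ is dense in $S_X$. -/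

import Mathlib

/-- `x` is a complex extreme point of the set `M`. -/
def IsComplexExtremePoint {X : Type*} [NormedAddCommGroup X] [NormedSpace ℂ X]
    (M : Set X) (x : X) : Prop :=
  x ∈ M ∧ ∀ y : X, y ≠ 0 → ∃ ζ : ℂ, ‖ζ‖ ≤ 1 ∧ x + ζ • y ∉ M

/-- Strict c-convexity: every point of the unit sphere is a complex extreme point of the closed
unit ball. -/
def IsStrictlyCConvex (X : Type*) [NormedAddCommGroup X] [NormedSpace ℂ X] : Prop :=
  ∀ x ∈ Metric.sphere (0 : X) 1, IsComplexExtremePoint (Metric.closedBall (0 : X) 1) x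

/-- The face `{x + y : y ∈ X, sup_{|ζ| ≤ 1} ‖x + ζ y‖ ≤ 1}` at `x`. -/
def complexFace {X : Type*} [NormedAddCommGroup X] [NormedSpace ℂ X] (x : X) : Set X :=
  {z | ∃ y : X, (∀ ζ : ℂ, ‖ζ‖ ≤ 1 → ‖x + ζ • y‖ ≤ 1) ∧ z = x + y}

/-- `x` has a strong face. (The face is nonempty when `‖x‖ = 1`, and the supremum is over a nonempty
bounded set of reals, so `Metric.infDist` and `sSup` have their usual meaning.) -/
def HasStrongFace {X : Type*} [NormedAddCommGroup X] [NormedSpace ℂ X] (x : X) : Prop :=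
  ∀ ε > (0 : ℝ), ∃ δ > (0 : ℝ), ∀ y : X, ε ≤ Metric.infDist y (complexFace x) →
    1 + δ ≤ sSup ((fun θ : ℝ => ‖x + Complex.exp ((θ : ℂ) * Complex.I) • (x - y)‖) ''
      Set.Icc 0 (2 * Real.pi))

/-- Local c-convexity: strict c-convexity, and every point of the unit sphere has a strong face. -/
def IsLocallyCConvex (X : Type*) [NormedAddCommGroup X] [NormedSpace ℂ X] : Prop :=
  IsStrictlyCConvex X ∧ ∀ x ∈ Metric.sphere (0 : X) 1, HasStrongFace x

/-- A (complex) Banach sequence space: a Banach space whose elements are complex sequences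
(distinct elements are distinct sequences, by `FunLike`) with the coordinatewise vector space
operations, such that every sequence `u` with `|u| ≤ |y|` for some `y ∈ X` belongs to `X` and
satisfies `‖u‖ ≤ ‖y‖`. -/
class IsBanachSequenceSpace (X : Type*) [NormedAddCommGroup X] [NormedSpace ℂ X]
    [FunLike X ℕ ℂ] : Prop extends CompleteSpace X where
  coe_add : ∀ (x y : X) (k : ℕ), (x + y) k = x k + y k
  coe_smul : ∀ (c : ℂ) (x : X) (k : ℕ), (c • x) k = c * x k
  solid : ∀ (u : ℕ → ℂ) (y : X), (∀ k, ‖u k‖ ≤ ‖y k‖) → ∃ x : X, (∀ k, x k = u k) ∧ ‖x‖ ≤ ‖y‖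

open scoped ComplexOrder in
/-- Order continuity of a sequence space: every sequence `0 ≤ x₀ ≤ x₁ ≤ ⋯ ≤ y` in `X`, with `y ∈ X`
positive, converges in norm. The order is coordinatewise; `a ≤ b` for complex numbers means that
`b - a` is real and nonnegative. -/
def IsOrderContinuous (X : Type*) [NormedAddCommGroup X] [FunLike X ℕ ℂ] : Prop :=
  ∀ (x : ℕ → X) (y : X), (∀ k, 0 ≤ y k) → (∀ k, 0 ≤ x 0 k) → (∀ n k, x n k ≤ x (n + 1) k) →
    (∀ n k, x n k ≤ y k) → ∃ l : X, Filter.Tendsto x Filter.atTop (nhds l)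

/-- The algebra `𝒜_u(B_X)` of the bounded, uniformly continuous functions on the closed unit ball
that are holomorphic on its interior. -/
def uniformBallAlgebra (X : Type*) [NormedAddCommGroup X] [NormedSpace ℂ X] :
    Set (BoundedContinuousFunction (Metric.closedBall (0 : X) 1) ℂ) :=
  {f | UniformContinuous f ∧ ∃ g : X → ℂ,
    DifferentiableOn ℂ g (interior (Metric.closedBall (0 : X) 1)) ∧
      ∀ x : Metric.closedBall (0 : X) 1, (x : X) ∈ interior (Metric.closedBall (0 : X) 1) →
        f x = g x}

/-- `S` is a strong peak set for the set `A` of bounded continuous functions on `K`. -/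
def IsStrongPeakSet {K : Type*} [MetricSpace K] (A : Set (BoundedContinuousFunction K ℂ))
    (S : Set K) : Prop :=
  ∃ f ∈ A, (∀ x ∈ S, f x = 1) ∧
    ∀ ε > (0 : ℝ), ∃ δ > (0 : ℝ), ∀ x : K, ε < Metric.infDist x S → ‖f x‖ < 1 - δ

/-- `p` is a strong peak point for `A`. -/
def IsStrongPeakPoint {K : Type*} [MetricSpace K] (A : Set (BoundedContinuousFunction K ℂ))
    (p : K) : Prop :=
  IsStrongPeakSet A {p}

/-!
The peak function at a unit vector `x₀` with finite support `F` is an explicit quadratic polynomial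
in the coordinates indexed by `F`.

Put `b k = x₀ k • eₖ` and let `g` be a norming functional of `x₀`. Solidity of the norm turns `g` into
weights `w k = ‖g (b k)‖` on `F` with `∑ w k = 1` and `∑ w k * ‖x k / x₀ k‖ ≤ ‖x‖` for all `x`. Strict
`c`-convexity makes the norm strictly monotone, so every `w k` with `k ∈ F` is positive
(`exists_weights`). In the coordinates `s k = x k / x₀ k` the problem becomes one about the point
`(1, …, 1)` of a weighted `ℓ¹` ball. For a small `c > 0` the polynomial
`h s = (1 + s) / 2 - c * (s - 1) ^ 2` satisfies `‖h s‖ ≤ (1 + ‖s‖) / 2 - κ * ‖s - 1‖ ^ 2` on a given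
disc (`exists_norm_le_sub_sq`), so `f x = ∑ w k * h (x k / x₀ k)` has `f x₀ = 1` and
`‖f x‖ ≤ 1 - κ * ∑ w k * ‖x k / x₀ k - 1‖ ^ 2` on the ball. Hence `f` is bounded away from `1` in modulus
unless `x` is close to `x₀` on `F`. In that case the strong face of `x₀` forces `x` to be close to `x₀`
in norm (`exists_norm_sub_lt_of_restrict`).

If the space is order continuous, the truncations of every vector converge to it
(`tendsto_restrict_Iio`), and density follows by normalizing them.
-/

/-! ### Coordinates and restrictions in Banach sequence spaces -/

namespace IsBanachSequenceSpace

variable {X : Type*} [NormedAddCommGroup X] [NormedSpace ℂ X] [FunLike X ℕ ℂ]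
  [IsBanachSequenceSpace X]

theorem norm_mono {x y : X} (h : ∀ k, ‖x k‖ ≤ ‖y k‖) : ‖x‖ ≤ ‖y‖ := by
  obtain ⟨z, hz, hzy⟩ := solid (X := X) (fun k => x k) y h
  rwa [DFunLike.ext z x hz] at hzy

theorem exists_coordCLM (X : Type*) [NormedAddCommGroup X] [NormedSpace ℂ X] [FunLike X ℕ ℂ]
    [IsBanachSequenceSpace X] (k : ℕ) : ∃ L : X →L[ℂ] ℂ, ∀ x, L x = x k := by
  have hb : ∃ C : ℝ, ∀ x : X, ‖x k‖ ≤ C * ‖x‖ := by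
    by_cases hz : ∃ z : X, z k ≠ 0
    · obtain ⟨z, hz⟩ := hz
      have hzn : 0 < ‖z k‖ := norm_pos_iff.2 hz
      obtain ⟨e, he, -⟩ := solid (X := X) (fun j => if j = k then z k else 0) z
        (fun j => by split_ifs with h <;> simp [h])
      have hen : 0 < ‖e‖ := by
        refine norm_pos_iff.2 fun h0 => hz ?_
        have h1 := coe_smul (0 : ℂ) e k
        rw [zero_smul, zero_mul, ← h0, he] at h1
        simpa using h1
      refine ⟨‖z k‖ / ‖e‖, fun x => ?_⟩
      have h2 : ‖(x k / z k) • e‖ ≤ ‖x‖ := by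
        refine norm_mono fun j => ?_
        rw [coe_smul, he]
        split_ifs with h
        · rw [div_mul_cancel₀ _ hz, h]
        · simp
      rw [norm_smul, norm_div, div_mul_eq_mul_div, div_le_iff₀ hzn] at h2
      rw [div_mul_eq_mul_div, le_div_iff₀ hen]
      linarith
    · push Not at hz
      exact ⟨0, fun x => by simp [hz x]⟩
  exact ⟨LinearMap.mkContinuousOfExistsBound
    { toFun := fun x => x k
      map_add' := fun x y => coe_add x y k
      map_smul' := fun c x => coe_smul c x k } hb, fun _ => rfl⟩

/-- The `k`-th coordinate as a continuous linear functional. -/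
noncomputable def coord (X : Type*) [NormedAddCommGroup X] [NormedSpace ℂ X] [FunLike X ℕ ℂ]
    [IsBanachSequenceSpace X] (k : ℕ) : X →L[ℂ] ℂ :=
  (exists_coordCLM X k).choose

@[simp] theorem coord_apply (k : ℕ) (x : X) : coord X k x = x k :=
  (exists_coordCLM X k).choose_spec x

theorem coe_zero (k : ℕ) : (0 : X) k = 0 := by
  simpa using (coord X k).map_zero

theorem coe_sub (x y : X) (k : ℕ) : (x - y) k = x k - y k := by
  simpa using (coord X k).map_sub x y

theorem coe_sum {ι : Type*} (s : Finset ι) (v : ι → X) (k : ℕ) :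
    (∑ i ∈ s, v i) k = ∑ i ∈ s, v i k := by
  simpa only [coord_apply] using map_sum (coord X k) v s

open Classical in
theorem exists_restrict (A : Set ℕ) (x : X) : ∃ y : X, ∀ k, y k = if k ∈ A then x k else 0 := by
  obtain ⟨y, hy, -⟩ := solid (X := X) (fun k => if k ∈ A then x k else 0) x
    (fun k => by split_ifs <;> simp)
  exact ⟨y, hy⟩

/-- The restriction of the sequence `x` to the set `A`, extended by zero. -/
noncomputable def restrict (A : Set ℕ) (x : X) : X := (exists_restrict A x).choose

theorem restrict_of_mem {A : Set ℕ} {k : ℕ} (h : k ∈ A) (x : X) : restrict A x k = x k := by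
  have := (exists_restrict A x).choose_spec k
  rwa [if_pos h] at this

theorem restrict_of_notMem {A : Set ℕ} {k : ℕ} (h : k ∉ A) (x : X) : restrict A x k = 0 := by
  have := (exists_restrict A x).choose_spec k
  rwa [if_neg h] at this

theorem sum_smul_restrict_singleton_apply (F : Finset ℕ) (a : ℕ → ℂ) (x : X) (j : ℕ) :
    (∑ k ∈ F, a k • restrict {k} x) j = if j ∈ F then a j * x j else 0 := by
  rw [coe_sum, ← Finset.sum_ite_eq F j (fun k => a k * x k)]
  refine Finset.sum_congr rfl fun k _ => ?_
  rw [coe_smul]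
  split_ifs with h
  · subst h; rw [restrict_of_mem (Set.mem_singleton _)]
  · rw [restrict_of_notMem (by simpa using h), mul_zero]

/-! ### Consequences of complex convexity -/

/-- Strict `c`-convexity makes the norm strictly monotone: deleting a nonzero coordinate of a unit
vector `x` shortens it, since otherwise all `x' + ζ • (x - x')` with `‖ζ‖ ≤ 1`, where `x'` is the
shortened vector, would lie in the ball, being dominated by `x`. -/
theorem norm_sub_restrict_singleton_lt (hX : IsStrictlyCConvex X) {x : X} (hx : ‖x‖ = 1) {j : ℕ}
    (hj : x j ≠ 0) : ‖x - restrict {j} x‖ < 1 := by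
  have hself := restrict_of_mem (Set.mem_singleton j) x
  have hother : ∀ k, k ≠ j → restrict {j} x k = 0 := fun k hk =>
    restrict_of_notMem (by simpa using hk) x
  by_contra! hge
  have hle : ‖x - restrict {j} x‖ ≤ ‖x‖ := norm_mono fun k => by
    rw [coe_sub]
    by_cases hk : k = j
    · rw [hk, hself]; simp
    · rw [hother k hk]; simp
  have hb : restrict {j} x ≠ 0 := fun h0 => hj (by rw [← hself, h0, coe_zero])
  obtain ⟨ζ, hζ, hout⟩ := (hX (x - restrict {j} x)
    (by rw [mem_sphere_zero_iff_norm]; exact le_antisymm (hle.trans hx.le) hge)).2 _ hb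
  refine hout ?_
  rw [mem_closedBall_zero_iff, ← hx]
  refine norm_mono fun k => ?_
  rw [coe_add, coe_sub, coe_smul]
  by_cases hk : k = j
  · rw [hk, hself, sub_self, zero_add, norm_mul]
    exact mul_le_of_le_one_left (norm_nonneg _) hζ
  · rw [hother k hk]; simp

/-- At a finitely supported unit vector `x₀`, the ball lies in a weighted `ℓ¹` ball that has `x₀` on
its boundary. The weights `w k = ‖g (x₀ k eₖ)‖` come from a norming functional `g` of `x₀`; strict
monotonicity of the norm makes them positive. -/
theorem exists_weights (hX : IsStrictlyCConvex X) {x₀ : X} (hx₀ : ‖x₀‖ = 1) (F : Finset ℕ)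
    (hF : ∀ k, k ∈ F ↔ x₀ k ≠ 0) :
    ∃ w : ℕ → ℝ, (∀ k ∈ F, 0 < w k) ∧ ∑ k ∈ F, w k = 1 ∧
      ∀ x : X, ∑ k ∈ F, w k * ‖x k / x₀ k‖ ≤ ‖x‖ := by
  obtain ⟨g, hg1, hg⟩ := exists_dual_vector ℂ x₀ (norm_ne_zero_iff.1 (by simp [hx₀]))
  have hg0 : g x₀ = 1 := by rw [hg, hx₀]; simp
  have hgle : ∀ x, ‖g x‖ ≤ ‖x‖ := fun x => by simpa [hg1] using g.le_opNorm x
  set b : ℕ → X := fun k => restrict {k} x₀ with hb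
  have hbound : ∀ x : X, ∑ k ∈ F, ‖g (b k)‖ * ‖x k / x₀ k‖ ≤ ‖x‖ := by
    intro x
    choose u hu1 hu using fun z : ℂ => RCLike.exists_norm_eq_mul_self z
    -- The phases `u` align the terms of `g (∑ k ∈ F, a k • b k)`.
    let a : ℕ → ℂ := fun k => ‖x k / x₀ k‖ * u (g (b k))
    have hv : ‖∑ k ∈ F, a k • b k‖ ≤ ‖x‖ := by
      refine norm_mono fun j => ?_
      rw [sum_smul_restrict_singleton_apply]
      split_ifs with hj
      · simp only [a, norm_mul, hu1, mul_one, Complex.norm_real, norm_norm, norm_div]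
        rw [div_mul_cancel₀ _ (norm_ne_zero_iff.2 ((hF j).1 hj))]
      · simp
    have hgv : g (∑ k ∈ F, a k • b k) = ((∑ k ∈ F, ‖g (b k)‖ * ‖x k / x₀ k‖ : ℝ) : ℂ) := by
      rw [map_sum, Complex.ofReal_sum]
      refine Finset.sum_congr rfl fun k _ => ?_
      have := hu (g (b k))
      rw [map_smul, smul_eq_mul, Complex.ofReal_mul]
      simp only [a]
      rw [mul_assoc, ← this, mul_comm]
      simp
    calc _ = ‖g (∑ k ∈ F, a k • b k)‖ := by
            rw [hgv, Complex.norm_real, Real.norm_of_nonneg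
              (Finset.sum_nonneg fun k _ => by positivity)]
      _ ≤ _ := (hgle _).trans hv
  have hsum : x₀ = ∑ k ∈ F, b k := by
    refine DFunLike.ext _ _ fun j => ?_
    have := sum_smul_restrict_singleton_apply F (fun _ => 1) x₀ j
    simp only [one_smul, one_mul] at this
    rw [this]
    split_ifs with hj
    · rfl
    · rw [hF] at hj; simpa using hj
  refine ⟨fun k => ‖g (b k)‖, fun k hk => ?_, le_antisymm ?_ ?_, hbound⟩
  · refine norm_pos_iff.2 fun h0 => ?_
    have h1 := norm_sub_restrict_singleton_lt hX hx₀ ((hF k).1 hk)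
    have h2 := hgle (x₀ - b k)
    rw [map_sub, h0, sub_zero, hg0, norm_one] at h2
    exact absurd h2 (not_le.2 h1)
  · rw [← hx₀]
    refine le_trans (le_of_eq (Finset.sum_congr rfl fun k hk => ?_)) (hbound x₀)
    rw [div_self ((hF k).1 hk), norm_one, mul_one]
  · calc (1 : ℝ) = ‖g (∑ k ∈ F, b k)‖ := by rw [← hsum, hg0, norm_one]
      _ ≤ _ := by rw [map_sum]; exact norm_sum_le _ _

/-- Vectors of the ball that are close to `x₀` on a set carrying `x₀` are close to `x₀`. The vector
`z = x₀ + (x - restrict A x)` is close to `x`, and `‖x₀ + ζ • (x₀ - z)‖ = ‖z‖` for unimodular `ζ` by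
solidity, so the strong face of `x₀`, which is `{x₀}`, forces `z` to be close to `x₀`. -/
theorem exists_norm_sub_lt_of_restrict (hX : IsLocallyCConvex X) {x₀ : X} (hx₀ : ‖x₀‖ = 1)
    {A : Set ℕ} (hA : ∀ k ∉ A, x₀ k = 0) {ε : ℝ} (hε : 0 < ε) :
    ∃ η > 0, ∀ x : X, ‖x‖ ≤ 1 → ‖restrict A x - x₀‖ < η → ‖x - x₀‖ < ε := by
  have hs : x₀ ∈ Metric.sphere (0 : X) 1 := by simpa using hx₀
  have hface : complexFace x₀ = {x₀} := by
    refine Set.eq_singleton_iff_unique_mem.2 ⟨⟨0, fun ζ _ => by simp [hx₀], by simp⟩, ?_⟩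
    rintro z ⟨y, hy, rfl⟩
    by_contra hne
    obtain ⟨ζ, hζ, hout⟩ := (hX.1 x₀ hs).2 y (by simpa using hne)
    exact hout (by simpa using hy ζ hζ)
  obtain ⟨δ, hδ, H⟩ := hX.2 x₀ hs (ε / 2) (half_pos hε)
  refine ⟨min (δ / 2) (ε / 2), by positivity, fun x hx hxA => ?_⟩
  have h1 := hxA.trans_le (min_le_left _ _)
  have h2 := hxA.trans_le (min_le_right _ _)
  set z : X := x₀ + (x - restrict A x) with hz
  have hxz : x - z = restrict A x - x₀ := by rw [hz]; abel
  have hzn : ‖z‖ ≤ 1 + δ / 2 := by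
    have h3 := norm_sub_le x (x - z)
    rw [sub_sub_cancel, hxz] at h3
    linarith
  have hzx : ‖z - x₀‖ < ε / 2 := by
    by_contra! hge
    have h3 := H z (by rwa [hface, Metric.infDist_singleton, dist_eq_norm])
    have h4 : sSup ((fun θ : ℝ => ‖x₀ + Complex.exp ((θ : ℂ) * Complex.I) • (x₀ - z)‖) ''
        Set.Icc 0 (2 * Real.pi)) ≤ 1 + δ / 2 := by
      refine csSup_le ⟨_, 0, ⟨le_rfl, by positivity⟩, rfl⟩ ?_
      rintro _ ⟨θ, -, rfl⟩
      refine le_trans (norm_mono fun k => ?_) hzn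
      have hzk : z k = x₀ k + (x k - restrict A x k) := by rw [hz, coe_add, coe_sub]
      rw [coe_add, coe_smul, coe_sub, hzk]
      by_cases hk : k ∈ A
      · rw [restrict_of_mem hk]; simp
      · rw [restrict_of_notMem hk, hA k hk]
        simp [Complex.norm_exp_ofReal_mul_I]
    linarith
  have h5 := norm_add_le (x - z) (z - x₀)
  rw [sub_add_sub_cancel, hxz] at h5
  linarith

/-! ### Order continuity -/

open scoped ComplexOrder in
/-- Order continuity applies to the truncations of `|x|`, which increase to `|x|`. Their distance to
`|x|` bounds that of the truncations of `x` to `x`. -/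
theorem tendsto_restrict_Iio (hX : IsOrderContinuous X) (x : X) :
    Filter.Tendsto (fun n => restrict (Set.Iio n) x) Filter.atTop (nhds x) := by
  obtain ⟨y, hy, -⟩ := solid (X := X) (fun k => (‖x k‖ : ℂ)) x (fun k => by simp)
  have hy0 : ∀ k, 0 ≤ y k := fun k => by rw [hy]; exact_mod_cast norm_nonneg _
  obtain ⟨l, hl⟩ := hX (fun n => restrict (Set.Iio n) y) y hy0
    (fun k => by rw [restrict_of_notMem (by simp)])
    (fun n k => by
      by_cases h : k < n
      · rw [restrict_of_mem (Set.mem_Iio.2 h), restrict_of_mem (Set.mem_Iio.2 (by omega))]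
      · rw [restrict_of_notMem (by simpa using h)]
        by_cases h' : k < n + 1
        · rw [restrict_of_mem (Set.mem_Iio.2 h')]; exact hy0 k
        · rw [restrict_of_notMem (by simpa using h')])
    (fun n k => by
      by_cases h : k < n
      · rw [restrict_of_mem (Set.mem_Iio.2 h)]
      · rw [restrict_of_notMem (by simpa using h)]; exact hy0 k)
  have hly : l = y := by
    refine DFunLike.ext _ _ fun k => ?_
    have h1 := ((coord X k).continuous.tendsto l).comp hl
    rw [coord_apply] at h1
    refine tendsto_nhds_unique h1 (tendsto_const_nhds.congr' ?_)
    filter_upwards [Filter.eventually_gt_atTop k] with n hn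
    simp [restrict_of_mem (Set.mem_Iio.2 hn)]
  rw [hly, tendsto_iff_norm_sub_tendsto_zero] at hl
  rw [tendsto_iff_norm_sub_tendsto_zero]
  refine squeeze_zero (fun _ => norm_nonneg _) (fun n => norm_mono fun k => ?_) hl
  rw [coe_sub, coe_sub]
  by_cases h : k < n
  · rw [restrict_of_mem (Set.mem_Iio.2 h), restrict_of_mem (Set.mem_Iio.2 h)]; simp
  · rw [restrict_of_notMem (by simpa using h), restrict_of_notMem (by simpa using h), hy]; simp

end IsBanachSequenceSpace

/-! ### The peak function -/

/-- The scalar estimate behind the peak function. For `‖s‖ = r` and `d = r - re s`,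
`((1 + r) / 2) ^ 2 - ‖(1 + s) / 2‖ ^ 2 = d / 2` controls the argument of `s`, and the quadratic
correction lowers the modulus where `s` is positive and different from `1`; the two effects
together give a gap of order `(r - 1) ^ 2 + 2 * d = ‖s - 1‖ ^ 2`. -/
theorem exists_norm_le_sub_sq {R : ℝ} (hR : 0 < R) :
    ∃ c κ : ℝ, 0 < κ ∧ ∀ s : ℂ, ‖s‖ ≤ R →
      ‖(1 + s) / 2 - c * (s - 1) ^ 2‖ ≤ (1 + ‖s‖) / 2 - κ * ‖s - 1‖ ^ 2 := by
  obtain ⟨c, hc⟩ : ∃ c : ℝ, c = 1 / (8 * (R + 1) ^ 2) := ⟨_, rfl⟩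
  have hcR : c * (R + 1) ^ 2 = 1 / 8 := by rw [hc]; field_simp
  have hc0 : 0 < c := by rw [hc]; positivity
  have hc8 : c ≤ 1 / 8 := by linarith [mul_pos hc0 hR, mul_pos (mul_pos hc0 hR) hR]
  obtain ⟨κ, hκ⟩ : ∃ κ : ℝ, κ = c / (8 * (R + 1)) := ⟨_, rfl⟩
  have hκ0 : 0 < κ := by rw [hκ]; positivity
  have hκR : κ * (R + 1) = c / 8 := by rw [hκ]; field_simp
  refine ⟨c, κ, hκ0, fun s hs => ?_⟩
  set r := ‖s‖ with hr
  have hr0 : 0 ≤ r := norm_nonneg s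
  have hrsq : r ^ 2 = s.re ^ 2 + s.im ^ 2 := by rw [hr, Complex.sq_norm, Complex.normSq_apply]; ring
  obtain ⟨d, hd⟩ : ∃ d, d = r - s.re := ⟨_, rfl⟩
  have hd0 : 0 ≤ d := by rw [hd]; exact sub_nonneg.2 (Complex.re_le_norm s)
  have him : s.im ^ 2 = r ^ 2 - (r - d) ^ 2 := by rw [hrsq, hd]; ring
  have hre : s.re = r - d := by rw [hd]; ring
  set q := ‖s - 1‖ ^ 2 with hq
  have hqe : q = (r - 1) ^ 2 + 2 * d := by
    rw [hq, Complex.sq_norm, Complex.normSq_apply]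
    simp only [Complex.sub_re, Complex.sub_im, Complex.one_re, Complex.one_im]
    linear_combination him + (s.re + r - d - 2) * hre
  have hq0 : 0 ≤ q := by positivity
  have hqR : q ≤ (R + 1) ^ 2 := by
    have := norm_sub_le s 1
    rw [norm_one] at this
    exact pow_le_pow_left₀ (norm_nonneg _) (by linarith) 2
  have hh : ‖(1 + s) / 2 - c * (s - 1) ^ 2‖ ^ 2 = ((1 + r) / 2) ^ 2 - d / 2
      - c * ((r - 1) ^ 2 * (r + 1) - 4 * r * d + 2 * d ^ 2 - (r ^ 2 - 1) * d) + c ^ 2 * q ^ 2 := by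
    have e : (1 + s) / 2 - c * (s - 1) ^ 2 =
        ⟨(1 + s.re) / 2 - c * ((s.re - 1) ^ 2 - s.im ^ 2),
          s.im / 2 - c * (2 * (s.re - 1) * s.im)⟩ := by
      apply Complex.ext
      · simp [pow_two]
      · simp [pow_two, -mul_eq_mul_left_iff, -sub_right_inj]
        ring
    rw [e, Complex.sq_norm, Complex.normSq_mk, hqe, hre]
    have e2 : (s.im / 2 - c * (2 * (r - d - 1) * s.im)) * (s.im / 2 - c * (2 * (r - d - 1) * s.im))
      = (1 / 2 - c * (2 * (r - d - 1))) ^ 2 * s.im ^ 2 := by ring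
    rw [e2, him]
    ring
  have hE : (r - 1) ^ 2 - 2 * (R + 1) ^ 2 * d ≤
      (r - 1) ^ 2 * (r + 1) - 4 * r * d + 2 * d ^ 2 - (r ^ 2 - 1) * d := by
    have h1 : 0 ≤ (r - 1) ^ 2 * r := by positivity
    have h2 : (4 * r + r ^ 2) * d ≤ (2 * (R + 1) ^ 2) * d :=
      mul_le_mul_of_nonneg_right
        (by linarith [pow_le_pow_left₀ hr0 hs 2, sq_nonneg R]) hd0
    linarith [sq_nonneg d]
  have hsq : ‖(1 + s) / 2 - c * (s - 1) ^ 2‖ ^ 2 ≤ ((1 + r) / 2) ^ 2 - c / 8 * q := by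
    have h1 := mul_le_mul_of_nonneg_left hE hc0.le
    have h2 : c ^ 2 * q ^ 2 ≤ c / 8 * q := by
      have h3 : c * q * c * q ≤ c * q * c * (R + 1) ^ 2 :=
        mul_le_mul_of_nonneg_left hqR (by positivity)
      linear_combination h3 + c * q * hcR
    have h4 : c * (2 * (R + 1) ^ 2 * d) = d / 4 := by linear_combination 2 * d * hcR
    have h5 : c * d ≤ 1 / 8 * d := mul_le_mul_of_nonneg_right hc8 hd0
    have h6 : 0 ≤ c * (r - 1) ^ 2 := by positivity
    have h7 : c / 8 * q = c * (r - 1) ^ 2 / 8 + c * d / 4 := by rw [hqe]; ring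
    rw [hh]
    linarith
  have hκq : κ * q ≤ 1 / 2 := by
    have h1 := mul_le_mul_of_nonneg_left hqR hκ0.le
    have h2 : κ * (R + 1) ^ 2 = c * (R + 1) / 8 := by linear_combination (R + 1) * hκR
    linarith [mul_pos hc0 hR, mul_pos (mul_pos hc0 hR) hR]
  refine (sq_le_sq₀ (norm_nonneg _) (by linarith)).1 ?_
  have h8 : κ * q * (1 + r) ≤ κ * q * (R + 1) :=
    mul_le_mul_of_nonneg_left (by linarith) (by positivity)
  have h9 : κ * q * (R + 1) = c / 8 * q := by linear_combination q * hκR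
  linarith [sq_nonneg (κ * q)]

open IsBanachSequenceSpace

theorem isStrongPeakPoint_of_finite_support {X : Type*} [NormedAddCommGroup X] [NormedSpace ℂ X]
    [FunLike X ℕ ℂ] [IsBanachSequenceSpace X] (hX : IsLocallyCConvex X) (x₀ : X)
    (hx₀ : x₀ ∈ Metric.sphere (0 : X) 1) (hfin : (Function.support x₀).Finite) :
    IsStrongPeakPoint (uniformBallAlgebra X) ⟨x₀, Metric.sphere_subset_closedBall hx₀⟩ := by
  have hn : ‖x₀‖ = 1 := by simpa using hx₀
  obtain ⟨F, hF⟩ : ∃ F : Finset ℕ, ∀ k, k ∈ F ↔ x₀ k ≠ 0 := ⟨hfin.toFinset, by simp⟩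
  obtain ⟨w, hw0, hw1, hw⟩ := exists_weights hX.1 hn F hF
  have hFne : F.Nonempty := Finset.nonempty_of_sum_ne_zero (by rw [hw1]; exact one_ne_zero)
  -- On the ball the quotients `x k / x₀ k` are bounded by `1 / w k`, hence by `R`.
  set R : ℝ := ∑ k ∈ F, 1 / w k with hRdef
  have hR : 0 < R := Finset.sum_pos (fun k hk => by have := hw0 k hk; positivity) hFne
  have hquot : ∀ x : X, ‖x‖ ≤ 1 → ∀ k ∈ F, ‖x k / x₀ k‖ ≤ R := by
    intro x hx k hk
    have h1 : w k * ‖x k / x₀ k‖ ≤ 1 := le_trans (Finset.single_le_sum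
      (f := fun k => w k * ‖x k / x₀ k‖)
      (fun i hi => mul_nonneg (hw0 i hi).le (norm_nonneg _)) hk) ((hw x).trans hx)
    have h2 : 1 / w k ≤ R := Finset.single_le_sum (f := fun k => 1 / w k)
      (fun i hi => by have := hw0 i hi; positivity) hk
    refine le_trans ?_ h2
    rw [le_div_iff₀ (hw0 k hk)]
    linarith
  obtain ⟨c, κ, hκ, hpeak⟩ := exists_norm_le_sub_sq hR
  set h : ℂ → ℂ := fun s => (1 + s) / 2 - c * (s - 1) ^ 2 with hh
  have hhd : Differentiable ℂ h := by rw [hh]; fun_prop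
  set f : X → ℂ := fun x => ∑ k ∈ F, (w k : ℂ) * h (coord X k x / x₀ k) with hf
  have hfd : Differentiable ℂ f := by
    rw [hf]
    refine Differentiable.fun_sum fun k _ => Differentiable.const_mul (hhd.comp ?_) _
    simp only [div_eq_mul_inv]
    exact (coord X k).differentiable.mul_const _
  have hfbound : ∀ x : X, ‖x‖ ≤ 1 → ‖f x‖ ≤ 1 - κ * ∑ k ∈ F, w k * ‖x k / x₀ k - 1‖ ^ 2 := by
    intro x hx
    have h1 : ‖f x‖ ≤ ∑ k ∈ F, w k * ((1 + ‖x k / x₀ k‖) / 2 - κ * ‖x k / x₀ k - 1‖ ^ 2) := by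
      refine norm_sum_le_of_le _ fun k hk => ?_
      rw [norm_mul, Complex.norm_real, Real.norm_of_nonneg (hw0 k hk).le, coord_apply]
      exact mul_le_mul_of_nonneg_left (hpeak _ (hquot x hx k hk)) (hw0 k hk).le
    have h2 : ∑ k ∈ F, w k * ((1 + ‖x k / x₀ k‖) / 2 - κ * ‖x k / x₀ k - 1‖ ^ 2)
        = (∑ k ∈ F, w k) / 2 + (∑ k ∈ F, w k * ‖x k / x₀ k‖) / 2
          - κ * ∑ k ∈ F, w k * ‖x k / x₀ k - 1‖ ^ 2 := by
      rw [Finset.sum_div, Finset.sum_div, Finset.mul_sum, ← Finset.sum_add_distrib,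
        ← Finset.sum_sub_distrib]
      exact Finset.sum_congr rfl fun k _ => by ring
    have h3 := hw x
    rw [h2, hw1] at h1
    linarith
  have hfuc : UniformContinuous fun x : Metric.closedBall (0 : X) 1 => f x := by
    have hk : ∀ k ∈ F, UniformContinuous fun x : Metric.closedBall (0 : X) 1 =>
        h (coord X k x / x₀ k) := by
      intro k hk
      have h1 : UniformContinuousOn h (Metric.closedBall 0 R) :=
        (isCompact_closedBall 0 R).uniformContinuousOn_of_continuous hhd.continuous.continuousOn
      have h2 : UniformContinuous fun x : X => coord X k x / x₀ k := by
        have := ((x₀ k)⁻¹ • coord X k).uniformContinuous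
        refine this.congr fun x => ?_
        simp [div_eq_inv_mul]
      rw [← uniformContinuousOn_univ]
      refine h1.comp (h2.comp uniformContinuous_subtype_val).uniformContinuousOn fun x _ => ?_
      simpa using hquot x (mem_closedBall_zero_iff.1 x.2) k hk
    rw [hf]
    have hsum : ∀ G ⊆ F, UniformContinuous fun x : Metric.closedBall (0 : X) 1 =>
        ∑ k ∈ G, (w k : ℂ) * h (coord X k x / x₀ k) := by
      intro G
      induction G using Finset.induction_on with
      | empty => intro _; simpa using uniformContinuous_const
      | insert a G ha ih =>
        intro hG
        simp only [Finset.sum_insert ha]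
        exact ((hk a (hG (Finset.mem_insert_self _ _))).const_smul (w a : ℂ)).add
          (ih fun i hi => hG (Finset.mem_insert_of_mem hi))
    exact hsum F subset_rfl
  have hf1 : ∀ x : Metric.closedBall (0 : X) 1, ‖f x‖ ≤ 1 := fun x => by
    refine (hfbound x (mem_closedBall_zero_iff.1 x.2)).trans (sub_le_self _ ?_)
    exact mul_nonneg hκ.le (Finset.sum_nonneg fun k hk => by have := hw0 k hk; positivity)
  refine ⟨BoundedContinuousFunction.ofNormedAddCommGroup (fun x => f x) hfuc.continuous 1 hf1,
    ⟨hfuc, f, hfd.differentiableOn, fun _ _ => rfl⟩, ?_, fun ε hε => ?_⟩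
  · rintro x rfl
    show f x₀ = 1
    have h1 : ∀ k ∈ F, (w k : ℂ) * h (coord X k x₀ / x₀ k) = (w k : ℂ) := fun k hk => by
      rw [coord_apply, div_self ((hF k).1 hk), hh]; norm_num
    simp only [hf]
    rw [Finset.sum_congr rfl h1, ← Complex.ofReal_sum, hw1, Complex.ofReal_one]
  · obtain ⟨η, hη, hclose⟩ := exists_norm_sub_lt_of_restrict hX hn (A := (F : Set ℕ))
      (fun k hk => by simpa [hF] using hk) hε
    -- By Cauchy-Schwarz, `M` compares the distance to `x₀` on `F` with the gap in `hfbound`.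
    set m : ℕ → ℝ := fun k => ‖restrict {k} x₀‖ with hm
    set M : ℝ := ∑ k ∈ F, m k ^ 2 / w k with hM
    have hM0 : 0 ≤ M := Finset.sum_nonneg fun k hk => by have := hw0 k hk; positivity
    refine ⟨κ * (η ^ 2 / (M + 1)) / 2, by positivity, fun x hx => ?_⟩
    rw [Metric.infDist_singleton, Subtype.dist_eq, dist_eq_norm] at hx
    have hx1 : ‖(x : X)‖ ≤ 1 := mem_closedBall_zero_iff.1 x.2
    have hfar : η ≤ ‖restrict (F : Set ℕ) (x : X) - x₀‖ := by
      by_contra! hlt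
      exact absurd (hclose x hx1 hlt) (not_lt.2 hx.le)
    set Q := ∑ k ∈ F, w k * ‖(x : X) k / x₀ k - 1‖ ^ 2 with hQ
    have hQ0 : 0 ≤ Q := Finset.sum_nonneg fun k hk => by have := hw0 k hk; positivity
    have hdecomp : restrict (F : Set ℕ) (x : X) - x₀ =
        ∑ k ∈ F, ((x : X) k / x₀ k - 1) • restrict {k} x₀ := by
      refine DFunLike.ext _ _ fun j => ?_
      rw [sum_smul_restrict_singleton_apply F (fun k => (x : X) k / x₀ k - 1), coe_sub]
      split_ifs with hj
      · rw [restrict_of_mem (Finset.mem_coe.2 hj), sub_mul, one_mul,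
          div_mul_cancel₀ _ ((hF j).1 hj)]
      · rw [restrict_of_notMem (by simpa using hj)]
        simpa [hF] using hj
    have hle : η ≤ ∑ k ∈ F, ‖(x : X) k / x₀ k - 1‖ * m k := by
      rw [hdecomp] at hfar
      exact hfar.trans (norm_sum_le_of_le _ fun k _ => (norm_smul _ _).le)
    have hCS : (∑ k ∈ F, ‖(x : X) k / x₀ k - 1‖ * m k) ^ 2 ≤ Q * M := by
      refine Finset.sum_sq_le_sum_mul_sum_of_sq_le_mul F
        (fun k hk => by have := hw0 k hk; positivity)
        (fun k hk => by have := hw0 k hk; positivity) (fun k hk => ?_)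
      have := (hw0 k hk).ne'
      exact le_of_eq (by field_simp)
    have hηQ : η ^ 2 / (M + 1) ≤ Q := by
      rw [div_le_iff₀ (by positivity)]
      have := pow_le_pow_left₀ hη.le hle 2
      nlinarith
    have h1 := hfbound x hx1
    have h2 := mul_le_mul_of_nonneg_left hηQ hκ.le
    have h3 : 0 < κ * (η ^ 2 / (M + 1)) := by positivity
    show ‖f x‖ < _
    linarith

theorem corollary3p4 (X : Type*) [NormedAddCommGroup X] [NormedSpace ℂ X] [FunLike X ℕ ℂ]
    [IsBanachSequenceSpace X] (hX : IsLocallyCConvex X) :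
    (∀ (x₀ : X) (hx₀ : x₀ ∈ Metric.sphere (0 : X) 1), (Function.support x₀).Finite →
      IsStrongPeakPoint (uniformBallAlgebra X) ⟨x₀, Metric.sphere_subset_closedBall hx₀⟩) ∧
    (IsOrderContinuous X →
      Dense {x : Metric.sphere (0 : X) 1 |
        IsStrongPeakPoint (uniformBallAlgebra X)
          ⟨(x : X), Metric.sphere_subset_closedBall x.2⟩}) := by
  refine ⟨isStrongPeakPoint_of_finite_support hX, fun hoc x => ?_⟩
  have hx : ‖(x : X)‖ = 1 := by simp
  -- Normalized truncations of `x` have finite support and converge to `x`.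
  have hlim := tendsto_restrict_Iio hoc (x : X)
  have hnorm : Filter.Tendsto (fun n => (‖restrict (Set.Iio n) (x : X)‖ : ℂ)⁻¹ •
      restrict (Set.Iio n) (x : X)) Filter.atTop (nhds (x : X)) := by
    have h1 : Filter.Tendsto (fun n => (‖restrict (Set.Iio n) (x : X)‖ : ℂ)⁻¹) Filter.atTop
        (nhds 1) := by
      have h2 := (Complex.continuous_ofReal.tendsto _).comp hlim.norm
      rw [hx, Complex.ofReal_one] at h2
      simpa using h2.inv₀ one_ne_zero
    simpa using h1.smul hlim
  rw [Metric.mem_closure_iff]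
  intro ε hε
  have hev : ∀ᶠ n in Filter.atTop, restrict (Set.Iio n) (x : X) ≠ 0 :=
    hlim.eventually_ne (norm_ne_zero_iff.1 (by simp [hx]))
  obtain ⟨n, hn0, hn⟩ := (hev.and (hnorm.eventually (Metric.ball_mem_nhds _ hε))).exists
  refine ⟨⟨_, by rw [mem_sphere_zero_iff_norm]; exact norm_smul_inv_norm (𝕜 := ℂ) hn0⟩, ?_, ?_⟩
  · refine isStrongPeakPoint_of_finite_support hX _
      (by rw [mem_sphere_zero_iff_norm]; exact norm_smul_inv_norm (𝕜 := ℂ) hn0)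
      ((Set.finite_Iio n).subset fun k hk => ?_)
    by_contra hkn
    exact hk (by rw [coe_smul, restrict_of_notMem hkn, mul_zero])
  · rw [dist_comm, Subtype.dist_eq]
    exact hn
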